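/- Let $k=\mathbb{F}_q$ be a finite field and let $F\in k[x,y]$ be an absolutely irreducible polynomial of total degree at least $2$. Write $F=a_n(x)y^n+\dots+a_0(x)$ with $a_n\neq 0$. Let $X_0=\operatorname{Spec} k[x,y]/(F)$ be the affine plane curve cut out by $F$, let $X\subseteq\mathbb{P}^2$ be its projective closure, let $\pi:\widetilde X\to X$ be the normalisation of $X$, and let $\varphi:X_0\to\mathbb{A}^1$ be the morphism $(x,y)\mapsto x$. Let $S_0\subseteq X_0$ be the set of singular points of $X_0$ (the common zeros on $X_0$ of $\partial F/\partial x$ and $\partial F/\partial y$), let $A\subseteq\mathbb{A}^1$ be the set of zeros of $a_n(x)$, and put $$Y_0:=\varphi(S_0)\cup A,\qquad Z_0:=\varphi^{-1}(Y_0),\qquad Y:=Y_0\cup\{\infty\}\subseteq\mathbb{P}^1,\qquad Z:=Z_0\cup(X\setminus X_0)\subseteq X.$$ Then there is exactly one morphism $\widetilde\varphi:\widetilde X\to\mathbb{P}^1$ given by the rational function $x$ (that is, taking the generic point of $\widetilde X$ to $[x:1]$), and $$\pi^{-1}(Z)=\widetilde\varphi^{\,-1}(Y)$$ as sets of points of $\widetilde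 X$ (equivalently, as reduced subschemes). -/

import Mathlib

open AlgebraicGeometry CategoryTheory
open scoped Polynomial.Bivariate

universe u

attribute [local instance] MvPolynomial.gradedAlgebra

namespace PlaneCurve

noncomputable section

/-- Projective `n`-space over `k`: `Proj k[X_0, …, X_n]` with the standard grading. -/
abbrev projSpace (k : Type u) [Field k] (n : ℕ) : Scheme.{u} :=
  Proj (MvPolynomial.homogeneousSubmodule (Fin (n + 1)) k)

/-- The ring homomorphism from the degree-zero part of `k[X_0, …, X_n][1 / X_i]` to a
`k`-algebra `R` that sends `X_j / X_i` to `v j / v i`, where `v i` is a unit. -/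
def chartHom (k : Type u) [Field k] {n : ℕ} {R : Type u} [CommRing R] [Algebra k R]
    (v : Fin (n + 1) → R) (i : Fin (n + 1)) (hi : IsUnit (v i)) :
    HomogeneousLocalization.Away (MvPolynomial.homogeneousSubmodule (Fin (n + 1)) k)
      (MvPolynomial.X i) →+* R :=
  (IsLocalization.Away.lift (S := Localization.Away (MvPolynomial.X i : MvPolynomial (Fin (n + 1)) k))
    (MvPolynomial.X i) (g := (MvPolynomial.aeval (R := k) v : _ →ₐ[k] R).toRingHom)
    (by simpa using hi)).comp
  (algebraMap _ _)

/-- The morphism `Spec R ⟶ ℙⁿ` over `k` with homogeneous coordinates `[v 0 : … : v n]`,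
where `v i` is a unit. -/
def toProj (k : Type u) [Field k] {n : ℕ} {R : Type u} [CommRing R] [Algebra k R]
    (v : Fin (n + 1) → R) (i : Fin (n + 1)) (hi : IsUnit (v i)) :
    Spec (.of R) ⟶ projSpace k n :=
  Spec.map (CommRingCat.ofHom (chartHom k v i hi)) ≫
    Proj.awayι (MvPolynomial.homogeneousSubmodule (Fin (n + 1)) k) (MvPolynomial.X i)
      (MvPolynomial.isHomogeneous_X k i) Nat.one_pos

section Polynomials

variable {k : Type u} [Field k]

/-- `F ∈ k[x, y]` is absolutely irreducible: it is irreducible over an algebraic closure. -/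
def AbsolutelyIrreducible (F : k[X][Y]) : Prop :=
  Irreducible (F.map (Polynomial.mapRingHom (algebraMap k (AlgebraicClosure k))))

/-- The total degree of `F ∈ k[x, y]`. -/
def totalDegree (F : k[X][Y]) : ℕ :=
  F.support.sup fun j => (F.coeff j).natDegree + j

/-- The partial derivative `∂F/∂x`, taken coefficientwise. -/
def partialX (F : k[X][Y]) : k[X][Y] :=
  F.sum fun j a => Polynomial.monomial j (Polynomial.derivative a)

/-- The partial derivative `∂F/∂y`. -/
def partialY (F : k[X][Y]) : k[X][Y] :=
  Polynomial.derivative F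

end Polynomials

section Curves

variable {k : Type u} [Field k] (F : k[X][Y])

/-- The coordinate function `x` on the affine plane curve `F = 0`. -/
def xCoord : AdjoinRoot F := AdjoinRoot.of F Polynomial.X

/-- The coordinate function `y` on the affine plane curve `F = 0`. -/
def yCoord : AdjoinRoot F := AdjoinRoot.root F

/-- The affine line `𝔸¹ = Spec k[x]`. -/
abbrev affineLine (k : Type u) [Field k] : Scheme.{u} := Spec (.of (Polynomial k))

/-- The affine plane curve `X₀ = Spec k[x, y] / (F)`. -/
abbrev affineCurve : Scheme.{u} := Spec (.of (AdjoinRoot F))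

/-- The inclusion `(x, y) ↦ [x : y : 1]` of `X₀` in the projective plane. -/
def affineCurveToPlane : affineCurve F ⟶ projSpace k 2 :=
  toProj k ![xCoord F, yCoord F, 1] 2 (by simp)

/-- The projective closure `X` of `X₀`: the scheme-theoretic image of `X₀` in `ℙ²`. -/
abbrev projectiveCurve : Scheme.{u} := (affineCurveToPlane F).image

/-- The inclusion `X₀ ⟶ X`. -/
def affineToProjective : affineCurve F ⟶ projectiveCurve F := (affineCurveToPlane F).toImage

/-- The function field `k(x)[y] / (F)`. -/
abbrev FunctionField : Type u := FractionRing (AdjoinRoot F)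

/-- The generic point `Spec k(X) ⟶ X` of `X`. -/
def genericPoint : Spec (.of (FunctionField F)) ⟶ projectiveCurve F :=
  Spec.map (CommRingCat.ofHom (algebraMap (AdjoinRoot F) (FunctionField F))) ≫
    affineToProjective F

instance : (projectiveCurve F).IsSeparated := by
  refine ⟨?_⟩
  rw [← Limits.terminal.comp_from (affineCurveToPlane F).imageι]
  infer_instance

instance : QuasiCompact (genericPoint F) := inferInstance

instance : QuasiSeparated (genericPoint F) := inferInstance

/-- The normalisation `X̃` of `X`: the relative spectrum of the integral closure of the structure
sheaf of `X` in the function field of `X`. -/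
abbrev normalisedCurve : Scheme.{u} := (genericPoint F).normalization

/-- The normalisation morphism `π : X̃ ⟶ X`. -/
def normalisationMap : normalisedCurve F ⟶ projectiveCurve F := (genericPoint F).fromNormalization

/-- The generic point `Spec k(X) ⟶ X̃` of `X̃`. -/
def normalisedGenericPoint : Spec (.of (FunctionField F)) ⟶ normalisedCurve F :=
  (genericPoint F).toNormalization

/-- The morphism `φ : X₀ ⟶ 𝔸¹`, `(x, y) ↦ x`. -/
def xProjection : affineCurve F ⟶ affineLine k := Spec.map (CommRingCat.ofHom (AdjoinRoot.of F))

/-- The inclusion `x ↦ [x : 1]` of `𝔸¹` in `ℙ¹`. -/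
def affineLineToProj (k : Type u) [Field k] : affineLine k ⟶ projSpace k 1 :=
  toProj k ![Polynomial.X, 1] 1 (by simp)

/-- The point `∞ = [1 : 0]` of `ℙ¹`. -/
def infinityPoint (k : Type u) [Field k] : Spec (.of k) ⟶ projSpace k 1 :=
  toProj k ![1, 0] 0 (by simp)

/-- A morphism `X̃ ⟶ ℙ¹` is the one given by the rational function `x` if its value at the generic
point of `X̃` is `[x : 1]`. -/
def IsGivenByX (φ : normalisedCurve F ⟶ projSpace k 1) : Prop :=
  normalisedGenericPoint F ≫ φ =
    toProj k ![algebraMap (AdjoinRoot F) (FunctionField F) (xCoord F), 1] 1 (by simp)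

/-- The singular points `S₀` of `X₀`: the points where `∂F/∂x` and `∂F/∂y` vanish. -/
def singularPoints : Set (affineCurve F) :=
  PrimeSpectrum.zeroLocus {AdjoinRoot.mk F (partialX F), AdjoinRoot.mk F (partialY F)}

/-- The zeros `A ⊆ 𝔸¹` of the leading coefficient of `F` as a polynomial in `y`. -/
def leadingCoeffZeros : Set (affineLine k) :=
  PrimeSpectrum.zeroLocus {F.leadingCoeff}

/-- `Y₀ = φ(S₀) ∪ A`. -/
def setY₀ : Set (affineLine k) := xProjection F '' singularPoints F ∪ leadingCoeffZeros F

/-- `Z₀ = φ⁻¹(Y₀)`. -/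
def setZ₀ : Set (affineCurve F) := xProjection F ⁻¹' setY₀ F

/-- `Y = Y₀ ∪ {∞}`. -/
def setY : Set (projSpace k 1) := affineLineToProj k '' setY₀ F ∪ Set.range (infinityPoint k)

/-- `Z = Z₀ ∪ (X ∖ X₀)`. -/
def setZ : Set (projectiveCurve F) :=
  affineToProjective F '' setZ₀ F ∪ (Set.range (affineToProjective F))ᶜ

end Curves

end

end PlaneCurve

/-! Write `K` for the function field, and let `O` be the local ring of the normalisation at a point
`P`. It embeds in `K` and is integrally closed there (`isIntegrallyClosedIn_stalk`). This property,
with the relation `F(x, y) = 0`, does all the work; no dimension theory or valuation rings are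
needed.

Existence: `x` or `x⁻¹` lies in every `O` (`xCoord_regular_or_inv_regular`). This is clear if `P`
maps to the chart of `ℙ²` where the first or third coordinate is invertible. In the remaining chart
`x/y` and `v = 1/y` lie in `O`, and if `v` is a unit then so does `x`. Otherwise `v^N F(x, y) = 0`,
with `N` the degree of `F` in `y`, is an equation for `x` over `O` that reduces modulo the maximal
ideal to the nonzero leading coefficient of `F`. A root of a polynomial with a unit coefficient lies
in `O` or has its inverse there. The resulting maps `Spec O ⟶ ℙ¹` agree at the generic point, hence
glue (`exists_extension_of_stalks`). Uniqueness holds because the generic point is dense and `ℙ¹` is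
separated.

Equality of sets is proved on complements. Over `X₀` the morphism is `φ ∘ π`
(`IsGivenByX.apply_eq`), so points over `X₀ ∖ Z₀` go to `𝔸¹ ∖ Y₀`. Conversely, if the value at `P`
is finite and outside `A`, the leading coefficient of `F` is a unit in `O`, so `y` is integral over
`O` and lies in it. Thus `P` lies over `X₀` (`IsGivenByX.exists_affine_point`), and its image is
outside `Z₀` by the first part. -/

namespace PlaneCurve

noncomputable section

/-! ### Homogeneous coordinates for morphisms to projective space -/

section Coordinates

open HomogeneousLocalization

variable {k : Type u} [Field k] {n : ℕ} {R S : Type u} [CommRing R] [Algebra k R]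
  [CommRing S] [Algebra k S]

lemma X_mem_homogeneousSubmodule (k : Type u) [Field k] {n : ℕ} (i : Fin (n + 1)) :
    MvPolynomial.X i ∈ MvPolynomial.homogeneousSubmodule (Fin (n + 1)) k 1 :=
  MvPolynomial.isHomogeneous_X k i

/-- Evaluation of degree-zero fractions with denominator a power of `f` at a tuple `v` for which
`f` takes a unit value. -/
def evalHom (k : Type u) [Field k] {n : ℕ} {R : Type u} [CommRing R] [Algebra k R]
    (v : Fin (n + 1) → R) (f : MvPolynomial (Fin (n + 1)) k)
    (hf : IsUnit (MvPolynomial.aeval v f)) :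
    Away (MvPolynomial.homogeneousSubmodule (Fin (n + 1)) k) f →+* R :=
  (IsLocalization.Away.lift (S := Localization.Away f) f
    (g := (MvPolynomial.aeval (R := k) v : _ →ₐ[k] R).toRingHom) hf).comp (algebraMap _ _)

/-- Clearing the denominator avoids inverses; later identities between such homomorphisms are
checked after multiplying by a power of a unit. -/
lemma evalHom_mk_mul (v : Fin (n + 1) → R) {f : MvPolynomial (Fin (n + 1)) k} {d : ℕ}
    (hf : IsUnit (MvPolynomial.aeval v f))
    (hfd : f ∈ MvPolynomial.homogeneousSubmodule (Fin (n + 1)) k d) (m : ℕ)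
    (p : MvPolynomial (Fin (n + 1)) k)
    (hp : p ∈ MvPolynomial.homogeneousSubmodule (Fin (n + 1)) k (m • d)) :
    evalHom k v f hf (Away.mk _ hfd m p hp) * MvPolynomial.aeval v f ^ m =
      MvPolynomial.aeval v p := by
  have key : algebraMap _ (Localization.Away f) p =
      Localization.mk p (⟨f ^ m, m, rfl⟩ : Submonoid.powers f) *
        algebraMap _ (Localization.Away f) (f ^ m) := by
    rw [Localization.mk_eq_mk', IsLocalization.mk'_spec]
  have := congrArg (IsLocalization.Away.lift (S := Localization.Away f) f
    (g := (MvPolynomial.aeval (R := k) v : _ →ₐ[k] R).toRingHom) hf) key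
  rw [map_mul, IsLocalization.Away.lift_eq, IsLocalization.Away.lift_eq] at this
  simp only [evalHom, RingHom.comp_apply, HomogeneousLocalization.algebraMap_apply, Away.val_mk]
  simpa using this.symm

lemma chartHom_eq_evalHom (v : Fin (n + 1) → R) (i : Fin (n + 1)) (hi : IsUnit (v i)) :
    chartHom k v i hi = evalHom k v (MvPolynomial.X i) (by simpa using hi) := rfl

lemma chartHom_mk_mul (v : Fin (n + 1) → R) (i : Fin (n + 1)) (hi : IsUnit (v i)) (m : ℕ)
    (p : MvPolynomial (Fin (n + 1)) k)
    (hp : p ∈ MvPolynomial.homogeneousSubmodule (Fin (n + 1)) k (m • 1)) :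
    chartHom k v i hi (Away.mk _ (X_mem_homogeneousSubmodule k i) m p hp) * v i ^ m =
      MvPolynomial.aeval v p := by
  have := evalHom_mk_mul v (f := MvPolynomial.X i) (by simpa using hi)
    (X_mem_homogeneousSubmodule k i) m p hp
  exact (congrArg (_ * · ^ m) (MvPolynomial.aeval_X (R := k) v i).symm).trans this

lemma evalHom_comp_awayMap (v : Fin (n + 1) → R) {f g x : MvPolynomial (Fin (n + 1)) k} {d e : ℕ}
    (hfd : f ∈ MvPolynomial.homogeneousSubmodule (Fin (n + 1)) k d)
    (hge : g ∈ MvPolynomial.homogeneousSubmodule (Fin (n + 1)) k e) (hx : x = f * g)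
    (hf : IsUnit (MvPolynomial.aeval v f)) (hx' : IsUnit (MvPolynomial.aeval v x)) :
    (evalHom k v x hx').comp
      (awayMap (MvPolynomial.homogeneousSubmodule (Fin (n + 1)) k) hge hx) = evalHom k v f hf := by
  ext z
  obtain ⟨m, p, hp, rfl⟩ := Away.mk_surjective _ hfd z
  subst hx
  refine (hx'.pow m).mul_left_injective ?_
  simp only [RingHom.comp_apply]
  rw [awayMap_mk, evalHom_mk_mul, map_mul, map_mul, mul_pow, map_pow, ← mul_assoc, evalHom_mk_mul]

lemma map_chartHom (φ : R →ₐ[k] S) (v : Fin (n + 1) → R) (w : Fin (n + 1) → S)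
    (hw : ∀ j, φ (v j) = w j) (i : Fin (n + 1)) (hi : IsUnit (v i)) (hi' : IsUnit (w i)) :
    φ.toRingHom.comp (chartHom k v i hi) = chartHom k w i hi' := by
  obtain rfl : φ ∘ v = w := funext hw
  ext z
  obtain ⟨m, p, hp, rfl⟩ := Away.mk_surjective _ (X_mem_homogeneousSubmodule k i) z
  refine (hi'.pow m).mul_left_injective ?_
  dsimp only
  rw [chartHom_mk_mul]
  have := congrArg φ (chartHom_mk_mul v i hi m p hp)
  rw [map_mul, map_pow] at this
  refine this.trans ?_
  exact DFunLike.congr_fun (MvPolynomial.comp_aeval (R := k) v φ) p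

/-- Numerator and denominator are homogeneous of the same degree `m`, so both acquire the factor `c
^ m`. -/
lemma chartHom_smul (v w : Fin (n + 1) → R) (c : R) (hw : ∀ j, w j = c * v j)
    (i : Fin (n + 1)) (hi : IsUnit (v i)) (hi' : IsUnit (w i)) :
    chartHom k w i hi' = chartHom k v i hi := by
  ext z
  obtain ⟨m, p, hp, rfl⟩ := Away.mk_surjective _ (X_mem_homogeneousSubmodule k i) z
  refine (hi'.pow m).mul_left_injective ?_
  dsimp only
  rw [chartHom_mk_mul, hw, mul_pow, mul_left_comm, chartHom_mk_mul]
  obtain rfl : (fun j => c * v j) = w := (funext hw).symm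
  rw [smul_eq_mul, mul_one] at hp
  simp only [MvPolynomial.aeval_def, MvPolynomial.eval₂_eq, Finset.mul_sum]
  refine Finset.sum_congr rfl fun d hd => ?_
  have hdeg : ∑ j ∈ d.support, d j = m := by
    have := hp (MvPolynomial.mem_support_iff.mp hd)
    rw [← this, Finsupp.weight_apply, Finsupp.sum]
    simp
  simp only [mul_pow, Finset.prod_mul_distrib, Finset.prod_pow_eq_pow_sum, hdeg]
  ring

lemma chartHom_X_div (v : Fin (n + 1) → R) (i j : Fin (n + 1)) (hi : IsUnit (v i)) :
    chartHom k v i hi (Away.isLocalizationElem (X_mem_homogeneousSubmodule k i)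
      (X_mem_homogeneousSubmodule k j)) * v i = v j := by
  calc _ = chartHom k v i hi (Away.isLocalizationElem (X_mem_homogeneousSubmodule k i)
        (X_mem_homogeneousSubmodule k j)) * v i ^ 1 := by rw [pow_one]
    _ = MvPolynomial.aeval v (MvPolynomial.X j ^ 1) := chartHom_mk_mul v i hi 1 _ _
    _ = v j := by simp

/-- The inclusion of the constants in the ring of degree-zero fractions. -/
def awayConst (f : MvPolynomial (Fin (n + 1)) k) :
    k →+* Away (MvPolynomial.homogeneousSubmodule (Fin (n + 1)) k) f :=
  (fromZeroRingHom (MvPolynomial.homogeneousSubmodule (Fin (n + 1)) k) _).comp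
    (algebraMap k (MvPolynomial.homogeneousSubmodule (Fin (n + 1)) k 0))

lemma chartHom_awayConst (v : Fin (n + 1) → R) (i : Fin (n + 1)) (hi : IsUnit (v i)) (c : k) :
    chartHom k v i hi (awayConst _ c) = algebraMap k R c := by
  simp only [chartHom, awayConst, RingHom.comp_apply, HomogeneousLocalization.algebraMap_apply]
  refine (IsLocalization.Away.lift_eq _ _ (MvPolynomial.C c)).trans ?_
  simp

/-- Followed by `φ`, the homomorphism becomes, after rescaling by `c`, the inclusion of the
degree-zero part in the full localization. -/
lemma chartHom_injective (v : Fin (n + 1) → R) (i : Fin (n + 1)) (hi : IsUnit (v i))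
    (φ : R →ₐ[k] Localization.Away (MvPolynomial.X i : MvPolynomial (Fin (n + 1)) k))
    (c : Localization.Away (MvPolynomial.X i : MvPolynomial (Fin (n + 1)) k))
    (h : ∀ j, φ (v j) = c * algebraMap (MvPolynomial (Fin (n + 1)) k) _ (MvPolynomial.X j)) :
    Function.Injective (chartHom k v i hi) := by
  have hX : IsUnit (algebraMap (MvPolynomial (Fin (n + 1)) k) (Localization.Away
      (MvPolynomial.X i : MvPolynomial (Fin (n + 1)) k)) (MvPolynomial.X i)) :=
    IsLocalization.Away.algebraMap_isUnit _
  have h₁ := map_chartHom φ v _ h i hi ((h i) ▸ hi.map φ)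
  rw [chartHom_smul (fun j => algebraMap _ _ (MvPolynomial.X j)) _ c (fun _ => rfl) i hX] at h₁
  have h₂ : chartHom k (fun j => algebraMap (MvPolynomial (Fin (n + 1)) k) (Localization.Away
      (MvPolynomial.X i : MvPolynomial (Fin (n + 1)) k)) (MvPolynomial.X j)) i hX =
        algebraMap _ _ := by
    ext z
    obtain ⟨m, p, hp, rfl⟩ := Away.mk_surjective _ (X_mem_homogeneousSubmodule k i) z
    refine (hX.pow m).mul_left_injective ?_
    dsimp only
    rw [chartHom_mk_mul, HomogeneousLocalization.algebraMap_apply, Away.val_mk,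
      Localization.mk_eq_mk', ← map_pow]
    refine Eq.trans ?_ (IsLocalization.mk'_spec _ p
      (⟨_, m, rfl⟩ : Submonoid.powers (MvPolynomial.X i))).symm
    exact (MvPolynomial.aeval_algebraMap_apply _ _ _).trans (by simp)
  refine Function.Injective.of_comp (f := φ.toRingHom) ?_
  rw [← RingHom.coe_comp, h₁, h₂]
  exact HomogeneousLocalization.val_injective _

lemma toProj_eq_comp (v : Fin (n + 1) → R) (i : Fin (n + 1)) (hi : IsUnit (v i)) :
    toProj k v i hi = Spec.map (CommRingCat.ofHom (chartHom k v i hi)) ≫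
      Proj.awayι _ _ (X_mem_homogeneousSubmodule k i) one_pos := rfl

/-- Both sides factor through the chart where `X i * X j` is invertible and are given there by the
same evaluation. -/
lemma toProj_eq_toProj (v : Fin (n + 1) → R) (i j : Fin (n + 1)) (hi : IsUnit (v i))
    (hj : IsUnit (v j)) : toProj k v i hi = toProj k v j hj := by
  have key (i j : Fin (n + 1)) (hi : IsUnit (v i)) (x : MvPolynomial (Fin (n + 1)) k)
      (hx : x = MvPolynomial.X i * MvPolynomial.X j) (hxv : IsUnit (MvPolynomial.aeval v x))
      (hxd : x ∈ MvPolynomial.homogeneousSubmodule (Fin (n + 1)) k (1 + 1)) :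
      toProj k v i hi = Spec.map (CommRingCat.ofHom (evalHom k v x hxv)) ≫
        Proj.awayι _ x hxd (by simp) := by
    rw [toProj, chartHom_eq_evalHom, ← evalHom_comp_awayMap v (X_mem_homogeneousSubmodule k i)
      (X_mem_homogeneousSubmodule k j) hx _ hxv, CommRingCat.ofHom_comp, Spec.map_comp,
      Category.assoc]
    congr 1
    exact Proj.SpecMap_awayMap_awayι _ _ _ _ _
  have hxv : IsUnit (MvPolynomial.aeval (R := k) v (MvPolynomial.X i * MvPolynomial.X j)) := by
    simpa using hi.mul hj
  have hxd := SetLike.mul_mem_graded (X_mem_homogeneousSubmodule k i)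
    (X_mem_homogeneousSubmodule k j)
  rw [key i j hi _ rfl hxv hxd, key j i hj _ (mul_comm _ _) hxv hxd]

lemma SpecMap_toProj (φ : R →ₐ[k] S) (v : Fin (n + 1) → R) (w : Fin (n + 1) → S)
    (hw : ∀ j, φ (v j) = w j) (i : Fin (n + 1)) (hi : IsUnit (v i)) (hi' : IsUnit (w i)) :
    Spec.map (CommRingCat.ofHom φ.toRingHom) ≫ toProj k v i hi = toProj k w i hi' := by
  rw [toProj, toProj, ← Category.assoc, ← Spec.map_comp, ← CommRingCat.ofHom_comp,
    map_chartHom φ v w hw]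

lemma toProj_smul (v w : Fin (n + 1) → R) (c : R) (hw : ∀ j, w j = c * v j)
    (i : Fin (n + 1)) (hi : IsUnit (v i)) (hi' : IsUnit (w i)) :
    toProj k w i hi' = toProj k v i hi := by
  rw [toProj, toProj, chartHom_smul v w c hw]

lemma toProj_preimage_basicOpen (v : Fin (n + 1) → R) (i j : Fin (n + 1)) (hi : IsUnit (v i))
    (p : Spec (.of R)) :
    toProj k v i hi p ∈ Proj.basicOpen (MvPolynomial.homogeneousSubmodule (Fin (n + 1)) k)
      (MvPolynomial.X j) ↔ v j ∉ p.asIdeal := by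
  have := Proj.awayι_preimage_basicOpen (MvPolynomial.homogeneousSubmodule (Fin (n + 1)) k)
    (X_mem_homogeneousSubmodule k i) one_pos (X_mem_homogeneousSubmodule k j) one_pos
  rw [toProj, Scheme.Hom.comp_apply]
  refine (SetLike.ext_iff.mp this _).trans ?_
  refine not_congr ?_
  rw [← chartHom_X_div (k := k) v i j hi]
  exact (Ideal.mul_unit_mem_iff_mem _ hi).symm

lemma iSup_basicOpen_X : ⨆ i, Proj.basicOpen
    (MvPolynomial.homogeneousSubmodule (Fin (n + 1)) k) (MvPolynomial.X i) = ⊤ := by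
  refine Proj.iSup_basicOpen_eq_top' _ _ (fun i => ⟨1, X_mem_homogeneousSubmodule k i⟩) ?_
  refine eq_top_iff.mpr fun p _ => ?_
  induction p using MvPolynomial.induction_on with
  | C c =>
    exact Subalgebra.algebraMap_mem (Algebra.adjoin _ _)
      (⟨MvPolynomial.C c, MvPolynomial.isHomogeneous_C _ c⟩ :
        MvPolynomial.homogeneousSubmodule (Fin (n + 1)) k 0)
  | add p q hp hq => exact add_mem (hp trivial) (hq trivial)
  | mul_X p i hp => exact mul_mem (hp trivial) (Algebra.subset_adjoin ⟨i, rfl⟩)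

lemma exists_mem_basicOpen_X (p : projSpace k n) : ∃ i, p ∈ Proj.basicOpen
    (MvPolynomial.homogeneousSubmodule (Fin (n + 1)) k) (MvPolynomial.X i) := by
  have : p ∈ (⊤ : (projSpace k n).Opens) := trivial
  rwa [← iSup_basicOpen_X, TopologicalSpace.Opens.mem_iSup] at this

/-- A morphism from a local scheme to projective space whose value at a field-valued point has
homogeneous coordinates `v` factors through a standard chart, where it is given by quotients of
the coordinates. -/
lemma exists_chartHom_lift {O K : Type u} [CommRing O] [IsLocalRing O] [Field K]
    [Algebra k K] (ψ : O →+* K) (g : Spec (.of O) ⟶ projSpace k n)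
    (v : Fin (n + 1) → K) (i₀ : Fin (n + 1)) (h₀ : IsUnit (v i₀))
    (hg : Spec.map (CommRingCat.ofHom ψ) ≫ g = toProj k v i₀ h₀) (i : Fin (n + 1))
    (hi : g (IsLocalRing.closedPoint O) ∈ Proj.basicOpen
      (MvPolynomial.homogeneousSubmodule (Fin (n + 1)) k) (MvPolynomial.X i)) :
    ∃ (hvi : IsUnit (v i)) (χ : Away (MvPolynomial.homogeneousSubmodule (Fin (n + 1)) k)
      (MvPolynomial.X i) →+* O), ψ.comp χ = chartHom k v i hvi ∧
      g = Spec.map (CommRingCat.ofHom χ) ≫ Proj.awayι _ _ (X_mem_homogeneousSubmodule k i)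
        one_pos := by
  -- Every point of a local scheme specializes to the closed point, so an open set containing the
  -- image of the closed point contains the whole image.
  have hrange : Set.range g ⊆
      Set.range (Proj.awayι _ _ (X_mem_homogeneousSubmodule k i) one_pos) := by
    rw [← Scheme.Hom.coe_opensRange (Proj.awayι _ _ _ _), Proj.opensRange_awayι]
    rintro _ ⟨p, rfl⟩
    exact ((IsLocalRing.specializes_closedPoint p).map g.continuous).mem_open
      (Proj.basicOpen _ _).isOpen hi
  let g' := IsOpenImmersion.lift (Proj.awayι _ _ (X_mem_homogeneousSubmodule k i) one_pos) g hrange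
  obtain ⟨χ, hχ⟩ := Spec.map_surjective g'
  have hg' : Spec.map χ ≫ Proj.awayι _ _ (X_mem_homogeneousSubmodule k i) one_pos = g := by
    rw [hχ]; exact IsOpenImmersion.lift_fac _ _ _
  have hvi : IsUnit (v i) := by
    have hp : toProj k v i₀ h₀ (⊥ : PrimeSpectrum K) ∈ Proj.basicOpen
        (MvPolynomial.homogeneousSubmodule (Fin (n + 1)) k) (MvPolynomial.X i) := by
      rw [← hg, ← Proj.opensRange_awayι _ _ (X_mem_homogeneousSubmodule k i) one_pos]
      exact hrange ⟨_, rfl⟩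
    replace hp := (toProj_preimage_basicOpen v i₀ i h₀ _).mp hp
    exact isUnit_iff_ne_zero.mpr fun h => hp (h ▸ zero_mem _)
  refine ⟨hvi, χ.hom, ?_, hg'.symm⟩
  rw [toProj_eq_toProj v i₀ i h₀ hvi, ← hg', ← Category.assoc, ← Spec.map_comp, toProj,
    cancel_mono] at hg
  exact congrArg CommRingCat.Hom.hom (Spec.map_injective hg)

end Coordinates

/-! ### The affine line and the point at infinity in `ℙ¹` -/

section Line

open HomogeneousLocalization

variable (k : Type u) [Field k]

lemma chartHom_polynomial_bijective (v : Fin (1 + 1) → Polynomial k) (i j : Fin (1 + 1))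
    (hij : ∀ l, l = i ∨ l = j) (hi : v i = 1) (hj : v j = Polynomial.X) :
    Function.Bijective (chartHom k v i (hi ▸ isUnit_one)) := by
  constructor
  · let L := Localization.Away (MvPolynomial.X i : MvPolynomial (Fin 2) k)
    have hX : IsUnit (algebraMap (MvPolynomial (Fin 2) k) L (MvPolynomial.X i)) :=
      IsLocalization.Away.algebraMap_isUnit _
    refine chartHom_injective v i _ (Polynomial.aeval
      (hX.unit⁻¹.1 * algebraMap (MvPolynomial (Fin 2) k) L (MvPolynomial.X j))) hX.unit⁻¹.1
      fun l => ?_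
    obtain rfl | rfl := hij l
    · simp [hi, L]
    · simp [hj, L]
  · rw [← RingHom.range_eq_top, eq_top_iff]
    rintro p -
    induction p using Polynomial.induction_on' with
    | add p q hp hq => exact add_mem hp hq
    | monomial m a =>
      rw [← Polynomial.C_mul_X_pow_eq_monomial]
      refine mul_mem ⟨awayConst _ a, chartHom_awayConst v i _ a⟩
        (pow_mem (RingHom.mem_range.mpr ⟨?_, ?_⟩) m)
      · exact Away.isLocalizationElem (X_mem_homogeneousSubmodule k i)
          (X_mem_homogeneousSubmodule k j)
      · have := chartHom_X_div (k := k) v i j (hi ▸ isUnit_one)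
        exact ((mul_one _).symm.trans (congrArg (_ * ·) hi.symm)).trans (this.trans hj)

/-- The two standard parametrisations of the complement of a point of `ℙ¹`. -/
lemma toProj_polynomial (v : Fin (1 + 1) → Polynomial k) (i j : Fin (1 + 1))
    (hij : ∀ l, l = i ∨ l = j) (hi : v i = 1) (hj : v j = Polynomial.X) :
    IsOpenImmersion (toProj k v i (hi ▸ isUnit_one)) ∧
      Set.range (toProj k v i (hi ▸ isUnit_one)) =
        Proj.basicOpen (MvPolynomial.homogeneousSubmodule (Fin (1 + 1)) k)
          (MvPolynomial.X i) := by
  let e := RingEquiv.ofBijective _ (chartHom_polynomial_bijective k v i j hij hi hj)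
  have : IsIso (CommRingCat.ofHom (chartHom k v i (hi ▸ isUnit_one))) :=
    e.toCommRingCatIso.isIso_hom
  constructor
  · rw [toProj_eq_comp]; infer_instance
  · rw [toProj_eq_comp, Scheme.Hom.comp_base, TopCat.coe_comp, Set.range_comp,
      Set.range_eq_univ.mpr (Spec.map (CommRingCat.ofHom (chartHom k v i _))).surjective,
      Set.image_univ, ← Proj.opensRange_awayι _ _ (X_mem_homogeneousSubmodule k i) one_pos]
    rfl

lemma range_affineLineToProj : Set.range (affineLineToProj k) =
    Proj.basicOpen (MvPolynomial.homogeneousSubmodule (Fin 2) k) (MvPolynomial.X 1) :=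
  (toProj_polynomial k ![Polynomial.X, 1] 1 0 (by decide) rfl rfl).2

instance : IsOpenImmersion (affineLineToProj k) :=
  (toProj_polynomial k ![Polynomial.X, 1] 1 0 (by decide) rfl rfl).1

lemma range_infinityPoint :
    Set.range (infinityPoint k) = (Set.range (affineLineToProj k))ᶜ := by
  rw [range_affineLineToProj]
  ext p
  constructor
  · rintro ⟨q, rfl⟩ h
    exact (toProj_preimage_basicOpen (k := k) ![1, 0] 0 1 (by simp) q).mp h (zero_mem _)
  · intro hp
    obtain ⟨i, hi⟩ := exists_mem_basicOpen_X p
    obtain rfl : i = 0 := by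
      fin_cases i
      · rfl
      · exact absurd hi hp
    rw [← SetLike.mem_coe,
      ← (toProj_polynomial k ![1, Polynomial.X] 0 1 (by decide) rfl rfl).2] at hi
    obtain ⟨q, rfl⟩ := hi
    -- In the other chart the coordinate is `X 1 / X 0`, which vanishes at a point outside `𝔸¹`. The
    -- prime `q` then contains the kernel of evaluation at `0`, so it comes from `Spec k`.
    have hq : (Polynomial.X : Polynomial k) ∈ q.asIdeal := by
      by_contra h
      exact hp ((toProj_preimage_basicOpen (k := k) ![1, Polynomial.X] 0 1 (by simp) q).mpr h)
    have hq' : q ∈ Set.range (Spec.map (CommRingCat.ofHom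
        (Polynomial.aeval (R := k) (0 : k)).toRingHom)) := by
      refine (range_comap_of_surjective _ _ ?_).ge ?_
      · exact fun c => ⟨Polynomial.C c, by simp⟩
      · intro f hf
        have : Polynomial.X ∣ f := by
          rw [Polynomial.X_dvd_iff, Polynomial.coeff_zero_eq_aeval_zero]
          simpa using hf
        exact q.asIdeal.mem_of_dvd this hq
    obtain ⟨t, rfl⟩ := hq'
    refine ⟨t, ?_⟩
    rw [← Scheme.Hom.comp_apply, SpecMap_toProj (Polynomial.aeval (R := k) (0 : k))
      ![1, Polynomial.X] ![1, 0] (by simp [Fin.forall_fin_two]) 0 _ (by simp)]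
    rfl

end Line

/-! ### Algebra of integrally closed local rings -/

section IntegrallyClosed

open Polynomial

variable {R K : Type*} [CommRing R] [Field K] [Algebra R K] [IsIntegrallyClosedIn R K]

/-- Over an integrally closed local ring, a root in the fraction field of a polynomial with a unit
coefficient lies in the ring or has its inverse there. -/
lemma mem_range_or_inv_mem_range_of_aeval_eq_zero [IsLocalRing R] (t : K) (p : R[X])
    (hp : ∃ j, IsUnit (p.coeff j)) (h0 : aeval t p = 0) :
    (∃ r, algebraMap R K r = t) ∨ (t ≠ 0 ∧ ∃ r, algebraMap R K r = t⁻¹) := by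
  -- Induction on a degree bound. With `c` the leading coefficient, `s = c * t` is integral, hence
  -- in `R`. If `c` or `s` is a unit, `t = s / c` or `t⁻¹ = c / s` lies in `R`.
  obtain ⟨n, hn⟩ : ∃ n, p.natDegree ≤ n := ⟨_, le_rfl⟩
  induction n generalizing p with
  | zero =>
    obtain ⟨j, hj⟩ := hp
    rw [Polynomial.eq_C_of_natDegree_le_zero hn] at h0 hj
    rw [aeval_C] at h0
    rcases eq_or_ne j 0 with rfl | hj0
    · rw [coeff_C_zero] at hj
      exact absurd h0 (hj.map (algebraMap R K)).ne_zero
    · rw [coeff_C_of_ne_zero hj0] at hj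
      exact absurd hj not_isUnit_zero
  | succ n ih =>
    by_cases hn' : p.natDegree ≤ n
    · exact ih p hp h0 hn'
    have hdeg : p.natDegree = n + 1 := by omega
    obtain ⟨s, hs⟩ := IsIntegrallyClosedIn.algebraMap_eq_of_integral
      (isIntegral_leadingCoeff_smul p t h0)
    rw [Algebra.smul_def] at hs
    set c := p.leadingCoeff with hc
    have hc' : p.coeff (n + 1) = c := by rw [hc, leadingCoeff, hdeg]
    by_cases hcu : IsUnit c
    · obtain ⟨u, hu⟩ := hcu
      refine .inl ⟨↑u⁻¹ * s, ?_⟩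
      rw [map_mul, hs, ← hu, ← mul_assoc, ← map_mul, Units.inv_mul, map_one, one_mul]
    by_cases hsu : IsUnit s
    · have hne := (hsu.map (algebraMap R K)).ne_zero
      rw [hs] at hne
      have ht := right_ne_zero_of_mul hne
      obtain ⟨u, hu⟩ := hsu
      refine .inr ⟨ht, c * ↑u⁻¹, ?_⟩
      refine eq_inv_of_mul_eq_one_left ?_
      rw [map_mul, mul_right_comm, ← hs, ← map_mul, ← hu,
        Units.mul_inv, map_one]
    have hcoeff (j : ℕ) : (p.erase (n + 1) + monomial n s).coeff j =
        (if j = n + 1 then 0 else p.coeff j) + if n = j then s else 0 := by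
      rw [coeff_add, coeff_erase, coeff_monomial]
    -- Otherwise rewrite `c * t ^ (n + 1)` as `s * t ^ n` to lower the degree. A unit coefficient
    -- survives, since it was not `c` and changes at most by the non-unit `s`.
    refine ih (p.erase (n + 1) + monomial n s) ?_ ?_ ?_
    · obtain ⟨j, hj⟩ := hp
      have hjn : j ≠ n + 1 := by rintro rfl; exact hcu (hc' ▸ hj)
      refine ⟨j, ?_⟩
      rw [hcoeff, if_neg hjn]
      split_ifs
      · by_contra h
        have := (IsLocalRing.maximalIdeal R).sub_mem ((IsLocalRing.mem_maximalIdeal _).mpr h)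
          ((IsLocalRing.mem_maximalIdeal s).mpr hsu)
        rw [add_sub_cancel_right] at this
        exact (IsLocalRing.mem_maximalIdeal _).mp this hj
      · rwa [add_zero]
    · have h1 : aeval t (monomial (n + 1) (p.coeff (n + 1)) + p.erase (n + 1)) = 0 := by
        rwa [monomial_add_erase]
      rw [map_add, aeval_monomial, hc', pow_succ'] at h1
      rw [map_add, aeval_monomial, hs, add_comm, mul_assoc]
      exact h1
    · rw [natDegree_le_iff_coeff_eq_zero]
      intro j hj
      rw [hcoeff, if_neg (show ¬ n = j by omega), add_zero]
      split_ifs with h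
      · rfl
      · exact coeff_eq_zero_of_natDegree_lt (by omega)

/-- If `(x, y)` satisfies a nontrivial polynomial relation over `k` and `y⁻¹` lies in the maximal
ideal of an integrally closed local ring, then `x` or `x⁻¹` lies in that ring. -/
lemma mem_range_or_inv_mem_range_of_relation [IsLocalRing R] {k : Type*} [Field k] [Algebra k R]
    [Algebra k K] [IsScalarTower k R K] (x y : K) (G : k[X][Y]) (hG : G ≠ 0)
    (h : G.eval₂ (aeval (R := k) x).toRingHom y = 0) (v : R) (hv : ¬ IsUnit v)
    (hvy : algebraMap R K v * y = 1) :
    (∃ r, algebraMap R K r = x) ∨ (x ≠ 0 ∧ ∃ r, algebraMap R K r = x⁻¹) := by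
  set N := G.natDegree
  -- This polynomial is `v ^ N * G(x, y)` rewritten with `v * y = 1`. Modulo the maximal ideal only
  -- the term `j = N` remains, so a nonzero coefficient of the leading coefficient of `G` gives a
  -- unit.
  refine mem_range_or_inv_mem_range_of_aeval_eq_zero x
    (∑ j ∈ Finset.range (N + 1), C (v ^ (N - j)) * (G.coeff j).map (algebraMap k R)) ?_ ?_
  · obtain ⟨i, hi⟩ : ∃ i, (G.coeff N).coeff i ≠ 0 := by
      by_contra! hcon
      exact hG (leadingCoeff_eq_zero.mp (Polynomial.ext hcon))
    refine ⟨i, ?_⟩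
    rw [finsetSum_coeff, Finset.sum_range_succ]
    simp only [coeff_C_mul, coeff_map, Nat.sub_self, pow_zero, one_mul]
    by_contra hcon
    have hmem : ∑ j ∈ Finset.range N, v ^ (N - j) * algebraMap k R ((G.coeff j).coeff i) ∈
        IsLocalRing.maximalIdeal R := by
      refine Ideal.sum_mem _ fun j hj => Ideal.mul_mem_right _ _ (Ideal.pow_mem_of_mem _
        ((IsLocalRing.mem_maximalIdeal v).mpr hv) _ ?_)
      have := Finset.mem_range.mp hj
      omega
    have := (IsLocalRing.maximalIdeal R).sub_mem ((IsLocalRing.mem_maximalIdeal _).mpr hcon) hmem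
    rw [add_sub_cancel_left] at this
    exact (IsLocalRing.mem_maximalIdeal _).mp this ((isUnit_iff_ne_zero.mpr hi).map _)
  · rw [map_sum]
    rw [eval₂_eq_sum_range] at h
    have := congrArg (algebraMap R K v ^ N * ·) h
    rw [mul_zero, Finset.mul_sum] at this
    rw [← this]
    refine Finset.sum_congr rfl fun j hj => ?_
    have hj' : N = (N - j) + j := by have := Finset.mem_range.mp hj; omega
    rw [map_mul, aeval_C, aeval_map_algebraMap, map_pow]
    conv_rhs => rw [hj', pow_add]
    have : algebraMap R K v ^ j * y ^ j = 1 := by rw [← mul_pow, hvy, one_pow]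
    calc _ = algebraMap R K v ^ (N - j) * aeval x (G.coeff j) *
          (algebraMap R K v ^ j * y ^ j) := by rw [this, mul_one]
      _ = _ := by simp only [AlgHom.toRingHom_eq_coe, RingHom.coe_coe]; ring

lemma mem_range_of_isUnit_leadingCoeff {A : Type*} [CommRing A] (φ : A →+* R) (G : A[X]) (y : K)
    (hG : IsUnit (φ G.leadingCoeff)) (h : G.eval₂ ((algebraMap R K).comp φ) y = 0) :
    ∃ s, algebraMap R K s = y := by
  have : Nontrivial R := (algebraMap R K).domain_nontrivial
  have hint := isIntegral_leadingCoeff_smul (G.map φ) y (by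
    rwa [aeval_def, eval₂_map])
  rw [leadingCoeff_map_of_leadingCoeff_ne_zero φ hG.ne_zero] at hint
  obtain ⟨s, hs⟩ := IsIntegrallyClosedIn.algebraMap_eq_of_integral hint
  obtain ⟨u, hu⟩ := hG
  refine ⟨↑u⁻¹ * s, ?_⟩
  rw [map_mul, hs, ← hu, Algebra.smul_def, ← mul_assoc, ← map_mul, Units.inv_mul, map_one, one_mul]

end IntegrallyClosed

/-! ### Descent of irreducibility to the base field -/

section Irreducible

variable {k : Type u} [Field k] {F : k[X][Y]}

open Polynomial in
lemma AbsolutelyIrreducible.irreducible (hF : AbsolutelyIrreducible F) : Irreducible F := by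
  -- Reflecting units suffices: a unit over the closure is a nonzero constant, and extension of the
  -- base field preserves both degrees.
  have : IsLocalHom (mapRingHom (mapRingHom (algebraMap k (AlgebraicClosure k)))) := by
    refine ⟨fun G hG => ?_⟩
    obtain ⟨a, ha, haG⟩ := Polynomial.isUnit_iff.mp hG
    obtain ⟨b, hb, rfl⟩ := Polynomial.isUnit_iff.mp ha
    have hinj : Function.Injective (mapRingHom (algebraMap k (AlgebraicClosure k))) :=
      Polynomial.map_injective _ (algebraMap k (AlgebraicClosure k)).injective
    have hG0 : G ≠ 0 := by rintro rfl; simp at hG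
    have hdeg : G.natDegree = 0 := by
      rw [← natDegree_map_eq_of_injective hinj, ← coe_mapRingHom, ← haG, natDegree_C]
    rw [eq_C_of_natDegree_eq_zero hdeg] at haG hG0 ⊢
    rw [coe_mapRingHom, map_C] at haG
    have h2 := (C_injective haG).symm
    have hdeg2 : (G.coeff 0).natDegree = 0 := by
      rw [← natDegree_map_eq_of_injective (algebraMap k (AlgebraicClosure k)).injective,
        ← coe_mapRingHom, h2, natDegree_C]
    rw [eq_C_of_natDegree_eq_zero hdeg2] at hG0 ⊢
    refine (IsUnit.map C (IsUnit.map C (isUnit_iff_ne_zero.mpr ?_)))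
    rintro h
    simp [h] at hG0
  exact Irreducible.of_map (f := mapRingHom (mapRingHom (algebraMap k (AlgebraicClosure k)))) hF

lemma AbsolutelyIrreducible.ne_zero (hF : AbsolutelyIrreducible F) : F ≠ 0 := hF.irreducible.ne_zero

lemma AbsolutelyIrreducible.isDomain (hF : AbsolutelyIrreducible F) : IsDomain (AdjoinRoot F) :=
  AdjoinRoot.isDomain_of_prime hF.irreducible.prime

end Irreducible

/-! ### Gluing morphisms given on stalks -/

section Gluing

/-- A morphism defined on a dominant scheme over `X` extends to `X` as soon as it extends to the
spectra of all the stalks. -/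
lemma exists_extension_of_stalks {X Z T : Scheme.{u}} [IsIntegral X] [Z.IsSeparated]
    [LocallyOfFiniteType (Limits.terminal.from Z)] (η : T ⟶ X) [IsDominant η] (h : T ⟶ Z)
    (H : ∀ P : X, ∃ (ηP : T ⟶ Spec (X.presheaf.stalk P)) (φ : Spec (X.presheaf.stalk P) ⟶ Z),
      ηP ≫ X.fromSpecStalk P = η ∧ ηP ≫ φ = h) :
    ∃ φ : X ⟶ Z, η ≫ φ = h := by
  choose ηP φ hη hφ using H
  -- Finite type over the terminal scheme lets each map from a stalk spread out to a neighbourhood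
  -- of its point.
  let g (P : X) : X.PartialMap Z := Scheme.PartialMap.ofFromSpecStalk
    (Limits.terminal.from X) (Limits.terminal.from Z) (φ P) (Limits.terminal.hom_ext _ _)
  have hPg (P : X) : P ∈ (g P).domain := Scheme.PartialMap.mem_domain_ofFromSpecStalk _ _ _ _
  have hfac (P : X) : ∃ ηU : T ⟶ (g P).domain, ηU ≫ (g P).domain.ι = η ∧ ηU ≫ (g P).hom = h := by
    refine ⟨ηP P ≫ (g P).domain.fromSpecStalkOfMem P (hPg P), ?_, ?_⟩
    · rw [Category.assoc, Scheme.Opens.fromSpecStalkOfMem_ι, hη]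
    · rw [Category.assoc]
      refine Eq.trans ?_ (hφ P)
      congr 1
      exact Scheme.PartialMap.fromSpecStalkOfMem_ofFromSpecStalk _ _ _ _
  -- `T` factors through the intersection of the two domains and is dominant there, so separatedness
  -- of `Z` forces agreement.
  have hequiv (P Q : X) : (g P).toRationalMap = (g Q).toRationalMap := by
    rw [Scheme.PartialMap.toRationalMap_eq_iff]
    refine ⟨(g P).domain ⊓ (g Q).domain, (g P).dense_domain.inter_of_isOpen_left
      (g Q).dense_domain (g P).domain.isOpen, inf_le_left, inf_le_right, ?_⟩
    let W := (g P).domain ⊓ (g Q).domain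
    obtain ⟨ηP, hηP, hP⟩ := hfac P
    obtain ⟨ηQ, hηQ, hQ⟩ := hfac Q
    have hrange : Set.range η ⊆ Set.range W.ι := by
      rw [Scheme.Opens.range_ι]
      rintro _ ⟨t, rfl⟩
      constructor
      · rw [← hηP]; exact (ηP t).2
      · rw [← hηQ]; exact (ηQ t).2
    have hlift : IsOpenImmersion.lift W.ι η hrange ≫ W.ι = η := IsOpenImmersion.lift_fac _ _ _
    have : IsDominant (IsOpenImmersion.lift W.ι η hrange ≫ W.ι) := by rwa [hlift]
    have := IsDominant.of_comp_of_isOpenImmersion (IsOpenImmersion.lift W.ι η hrange) W.ι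
    have h₁ : IsOpenImmersion.lift W.ι η hrange ≫ X.homOfLE inf_le_left = ηP := by
      rw [← cancel_mono (g P).domain.ι, Category.assoc, Scheme.homOfLE_ι, hlift, hηP]
    have h₂ : IsOpenImmersion.lift W.ι η hrange ≫ X.homOfLE inf_le_right = ηQ := by
      rw [← cancel_mono (g Q).domain.ι, Category.assoc, Scheme.homOfLE_ι, hlift, hηQ]
    exact ext_of_isDominant (f := X.homOfLE inf_le_left ≫ (g P).hom)
      (g := X.homOfLE inf_le_right ≫ (g Q).hom) (IsOpenImmersion.lift W.ι η hrange)
      (by rw [reassoc_of% h₁, reassoc_of% h₂, hP, hQ])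
  obtain ⟨P₀⟩ : Nonempty X := inferInstance
  let f := (g P₀).toRationalMap
  have htop : f.domain = ⊤ := by
    refine eq_top_iff.mpr fun P _ => ?_
    exact Scheme.RationalMap.mem_domain.mpr ⟨g P, hPg P, hequiv P P₀⟩
  let e := X.isoOfEq htop ≪≫ X.topIso
  have he : e.hom = f.domain.ι := by simp [e]
  obtain ⟨η₀, hη₀, h₀⟩ := hfac P₀
  let f' : f.domain.toScheme ⟶ Z := f.toPartialMap.hom
  have hf' : X.homOfLE (g P₀).le_domain_toRationalMap ≫ f' = (g P₀).hom :=
    (g P₀).toPartialMap_toRationalMap_restrict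
  refine ⟨e.inv ≫ f', ?_⟩
  have : η ≫ e.inv = η₀ ≫ X.homOfLE (g P₀).le_domain_toRationalMap := by
    rw [Iso.comp_inv_eq, he, Category.assoc, Scheme.homOfLE_ι, hη₀]
  rw [reassoc_of% this, hf', h₀]

end Gluing

/-! ### Integral closedness of the stalks of the normalisation -/

section IntegrallyClosed

/-- Removes the algebra instance, so that the property can be rewritten along equalities of ring
homomorphisms. -/
lemma isIntegrallyClosedIn_iff_ringHom {R S : Type*} [CommRing R] [CommRing S] (f : R →+* S) :
    (letI := f.toAlgebra; IsIntegrallyClosedIn R S) ↔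
      Function.Injective f ∧ ∀ x, f.IsIntegralElem x → ∃ r, f r = x := by
  let := f.toAlgebra
  exact isIntegrallyClosedIn_iff

lemma isIntegrallyClosedIn_comp {R R' S S' : Type*} [CommRing R] [CommRing R'] [CommRing S]
    [CommRing S'] (e : R' →+* R) (f : R →+* S) (e' : S →+* S') (he : Function.Bijective e)
    (he' : Function.Bijective e') (hf : letI := f.toAlgebra; IsIntegrallyClosedIn R S) :
    letI := ((e'.comp f).comp e).toAlgebra; IsIntegrallyClosedIn R' S' := by
  rw [isIntegrallyClosedIn_iff_ringHom] at hf ⊢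
  refine ⟨(he'.1.comp hf.1).comp he.1, fun x hx => ?_⟩
  obtain ⟨y, rfl⟩ := he'.2 x
  obtain ⟨p, hp, hpx⟩ := hx
  obtain ⟨r, hr⟩ := hf.2 y ⟨p.map e, hp.map e, he'.1 (by
    rw [map_zero, ← hpx, Polynomial.eval₂_map, Polynomial.hom_eval₂]; rfl)⟩
  obtain ⟨r, rfl⟩ := he.2 r
  exact ⟨r, congrArg e' hr⟩

lemma isIntegrallyClosedIn_of_isLocalization {R L K : Type*} [CommRing R] [CommRing L] [Field K]
    [Algebra R L] (M : Submonoid R) [IsLocalization M L] (g : L →+* K)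
    (hg : letI := (g.comp (algebraMap R L)).toAlgebra; IsIntegrallyClosedIn R K) :
    letI := g.toAlgebra; IsIntegrallyClosedIn L K := by
  let := g.toAlgebra
  let := (g.comp (algebraMap R L)).toAlgebra
  have : IsScalarTower R L K := .of_algebraMap_eq' rfl
  have hu (m : M) : g (algebraMap R L m) ≠ 0 := ((IsLocalization.map_units L m).map g).ne_zero
  refine isIntegrallyClosedIn_iff.mpr ⟨?_, fun {x} hx => ?_⟩
  · refine (injective_iff_map_eq_zero g).mpr fun l hl => ?_
    obtain ⟨a, m, rfl⟩ := IsLocalization.exists_mk'_eq M l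
    have h := congrArg g (IsLocalization.mk'_spec L a m)
    rw [map_mul, hl, zero_mul] at h
    have : a = 0 := (isIntegrallyClosedIn_iff.mp hg).1 (by rw [map_zero]; exact h.symm)
    rw [this, IsLocalization.mk'_zero]
  · obtain ⟨m, hm⟩ := IsIntegral.exists_multiple_integral_of_isLocalization M x hx
    obtain ⟨a, ha⟩ := (isIntegrallyClosedIn_iff.mp hg).2 hm
    refine ⟨IsLocalization.mk' L a m, mul_right_cancel₀ (hu m) ?_⟩
    have h := congrArg g (IsLocalization.mk'_spec L a m)
    rw [map_mul] at h
    refine h.trans (ha.trans ?_)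
    rw [Submonoid.smul_def, Algebra.smul_def, mul_comm]
    rfl

end IntegrallyClosed

section Stalk

variable {X : Scheme.{u}} {K : Type u} [Field K] (η : Spec (.of K) ⟶ X) [IsDominant η]

lemma dominant_specializes (P : X) : η (IsLocalRing.closedPoint K) ⤳ P := by
  rw [specializes_iff_mem_closure]
  have : Set.range η = {η (IsLocalRing.closedPoint K)} := by
    ext x
    constructor
    · rintro ⟨t, rfl⟩
      exact congrArg η (Subsingleton.elim (α := PrimeSpectrum K) t _)
    · rintro rfl
      exact ⟨_, rfl⟩
  rw [← this, η.denseRange.closure_range]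
  trivial

/-- The homomorphism from the stalk at `P` to `K` when `X` is dominated by `Spec K`. -/
def stalkToField (P : X) : X.presheaf.stalk P ⟶ .of K :=
  X.presheaf.stalkSpecializes (dominant_specializes η P) ≫ Scheme.stalkClosedPointTo η

lemma SpecMap_stalkToField (P : X) : Spec.map (stalkToField η P) ≫ X.fromSpecStalk P = η := by
  rw [stalkToField, Spec.map_comp, Category.assoc, Scheme.SpecMap_stalkSpecializes_fromSpecStalk,
    Scheme.Spec_stalkClosedPointTo_fromSpecStalk]

end Stalk

section NormalizationStalk

variable {X : Scheme.{u}} {K : Type u} [Field K] (η : Spec (.of K) ⟶ X)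
  [QuasiCompact η] [QuasiSeparated η]

/-- The stalk localizes the sections over the preimage of an affine open `U`. These form the
integral closure of `Γ(X, U)` in the sections over `η ⁻¹ᵁ U`, a ring identified with `K` since `η
⁻¹ᵁ U` is all of `Spec K`. -/
lemma isIntegrallyClosedIn_stalk (P : η.normalization) :
    letI := (stalkToField η.toNormalization P).hom.toAlgebra
    IsIntegrallyClosedIn (η.normalization.presheaf.stalk P) K := by
  obtain ⟨_, ⟨U, hU, rfl⟩, hxU, -⟩ := X.isBasis_affineOpens.exists_subset_of_mem_open
    (Set.mem_univ (η.fromNormalization P)) isOpen_univ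
  let V := η.fromNormalization ⁻¹ᵁ U
  have hV : IsAffineOpen V := hU.preimage _
  have hPV : P ∈ V := hxU
  let := (η.normalization.presheaf.germ V P hPV).hom.toAlgebra
  have : IsLocalization.AtPrime (η.normalization.presheaf.stalk P)
      (hV.primeIdealOf ⟨P, hPV⟩).asIdeal := hV.isLocalization_stalk ⟨P, hPV⟩
  refine isIntegrallyClosedIn_of_isLocalization (hV.primeIdealOf ⟨P, hPV⟩).asIdeal.primeCompl _ ?_
  have hmem : η.toNormalization (IsLocalRing.closedPoint K) ∈ V :=
    (dominant_specializes η.toNormalization P).mem_open V.isOpen hPV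
  let := (η.app U).hom.toAlgebra
  have key : η.normalization.presheaf.germ V P hPV ≫ stalkToField η.toNormalization P =
      (η.normalizationObjIso hU).hom ≫
        CommRingCat.ofHom (integralClosure Γ(X, U) Γ(Spec (.of K), η ⁻¹ᵁ U)).val.toRingHom ≫
        ((Spec (.of K)).presheaf.map (eqToHom (by simp [V, ← Scheme.Hom.comp_preimage])).op ≫
        ((Spec (.of K)).presheaf.mapIso (eqToIso (Scheme.preimage_eq_top_of_closedPoint_mem
          η.toNormalization hmem).symm).op ≪≫ Scheme.ΓSpecIso (.of K)).hom) := by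
    rw [stalkToField, TopCat.Presheaf.germ_stalkSpecializes_assoc,
      Scheme.germ_stalkClosedPointTo _ V hmem, η.toNormalization_app_preimage ⟨U, hU⟩]
    simp only [Category.assoc]
    rfl
  have hbij {A B : CommRingCat.{u}} (f : A ⟶ B) [IsIso f] : Function.Bijective f.hom :=
    ConcreteCategory.bijective_of_isIso f
  have hcl : IsIntegrallyClosedIn (integralClosure Γ(X, U) Γ(Spec (.of K), η ⁻¹ᵁ U))
    Γ(Spec (.of K), η ⁻¹ᵁ U) := inferInstance
  have := isIntegrallyClosedIn_comp _ _ _ (hbij (η.normalizationObjIso hU).hom)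
    (hbij ((Spec (.of K)).presheaf.map (eqToHom (by simp [V, ← Scheme.Hom.comp_preimage])).op ≫
        ((Spec (.of K)).presheaf.mapIso (eqToIso (Scheme.preimage_eq_top_of_closedPoint_mem
          η.toNormalization hmem).symm).op ≪≫ Scheme.ΓSpecIso (.of K)).hom)) hcl
  rw [isIntegrallyClosedIn_iff_ringHom] at this ⊢
  have hkey := congrArg CommRingCat.Hom.hom key
  rw [CommRingCat.hom_comp] at hkey
  rw [RingHom.algebraMap_toAlgebra, hkey]
  exact this

end NormalizationStalk

lemma eq_of_SpecMap_comp_eq {O K : Type u} [CommRing O] [IsDomain O] [CommRing K] (ψ : O →+* K)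
    (hψ : Function.Injective ψ) {Z : Scheme.{u}} [Z.IsSeparated] (g₁ g₂ : Spec (.of O) ⟶ Z)
    (h : Spec.map (CommRingCat.ofHom ψ) ≫ g₁ = Spec.map (CommRingCat.ofHom ψ) ≫ g₂) :
    g₁ = g₂ := by
  have : IsDominant (Spec.map (CommRingCat.ofHom ψ)) :=
    ⟨(PrimeSpectrum.denseRange_comap_iff_ker_le_nilRadical _).mpr
      (((RingHom.injective_iff_ker_eq_bot ψ).mp hψ).le.trans bot_le)⟩
  exact ext_of_isDominant _ h

/-- The gluing works over the terminal scheme. As `k` is finite, the degree-zero part is a finite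
ring, hence of finite type over `ℤ`. -/
lemma locallyOfFiniteType_projSpace (k : Type u) [Field k] [Finite k] (n : ℕ) :
    LocallyOfFiniteType (Limits.terminal.from (projSpace k n)) := by
  let A := MvPolynomial (Fin (n + 1)) k
  let A₀ := MvPolynomial.homogeneousSubmodule (Fin (n + 1)) k 0
  have : IsScalarTower k A₀ A := ⟨fun a b c => smul_mul_assoc a (b : A) c⟩
  have : Algebra.FiniteType A₀ A := .of_restrictScalars_finiteType k A₀ A
  have : Finite A₀ := by
    refine Finite.of_surjective (fun c : k => algebraMap k A₀ c) fun p => ?_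
    exact ⟨_, Subtype.ext (MvPolynomial.totalDegree_eq_zero_iff_eq_C.mp
      (Nat.le_zero.mp (MvPolynomial.IsHomogeneous.totalDegree_le p.2))).symm⟩
  let f : ULift.{u} ℤ →+* A₀ := (Int.castRingHom A₀).comp ULift.ringEquiv.toRingHom
  have hf : f.FiniteType := by
    have : Module.Finite ℤ A₀ := Module.Finite.of_finite
    have h : (Int.castRingHom A₀).FiniteType :=
      RingHom.finiteType_algebraMap.mpr (inferInstanceAs (Algebra.FiniteType ℤ A₀))
    exact h.comp (RingHom.FiniteType.of_surjective _ ULift.ringEquiv.surjective)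
  have : LocallyOfFiniteType (Spec.map (CommRingCat.ofHom f)) :=
    HasRingHomProperty.Spec_iff.mpr hf
  have : Limits.terminal.from (projSpace k n) =
      Proj.toSpecZero (MvPolynomial.homogeneousSubmodule (Fin (n + 1)) k) ≫
        Spec.map (CommRingCat.ofHom f) ≫
        (specULiftZIsTerminal.uniqueUpToIso Limits.terminalIsTerminal).hom :=
    Limits.terminal.hom_ext _ _
  rw [this]
  infer_instance

lemma exists_toProj_extension {k O K : Type u} [Field k] [CommRing O] [Field K] [Algebra k K]
    (ψ : O →+* K) (κ : k →+* O) (hκ : ψ.comp κ = algebraMap k K) (x : K)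
    (hx : (∃ r, ψ r = x) ∨ (x ≠ 0 ∧ ∃ r, ψ r = x⁻¹)) :
    ∃ φ : Spec (.of O) ⟶ projSpace k 1,
      Spec.map (CommRingCat.ofHom ψ) ≫ φ = toProj k ![x, 1] 1 (by simp) := by
  let := κ.toAlgebra
  let ψ' : O →ₐ[k] K := { ψ with commutes' := fun c => RingHom.congr_fun hκ c }
  rcases hx with ⟨r, hr⟩ | ⟨hx, r, hr⟩
  · exact ⟨toProj k ![r, 1] 1 (by simp),
      SpecMap_toProj ψ' _ _ (Fin.forall_fin_two.mpr ⟨hr, map_one ψ⟩) _ _ _⟩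
  · refine ⟨toProj k ![1, r] 0 (by simp), ?_⟩
    refine (SpecMap_toProj ψ' ![1, r] ![1, x⁻¹]
      (Fin.forall_fin_two.mpr ⟨map_one ψ, hr⟩) 0 _ (by simp)).trans ?_
    refine (toProj_eq_toProj ![1, x⁻¹] 0 1 _ (by simpa using hx)).trans ?_
    exact (toProj_smul _ _ x (Fin.forall_fin_two.mpr ⟨by simp, by simp [hx]⟩) _ _ _).symm

/-! ### The affine curve as an open part of its projective closure -/

section Immersion

variable {k : Type u} [Field k] (F : k[X][Y])

lemma chartHom_surjective : Function.Surjective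
    (chartHom k ![xCoord F, yCoord F, 1] 2 (by simp)) := by
  rw [← RingHom.range_eq_top, eq_top_iff]
  have hx (j : Fin 3) : ![xCoord F, yCoord F, 1] j ∈
      (chartHom k ![xCoord F, yCoord F, 1] 2 (by simp)).range :=
    ⟨_, (mul_one _).symm.trans (chartHom_X_div (k := k) ![xCoord F, yCoord F, 1] 2 j (by simp))⟩
  rintro z -
  obtain ⟨G, rfl⟩ := AdjoinRoot.mk_surjective z
  induction G using Polynomial.induction_on' with
  | add p q hp hq => rw [map_add]; exact add_mem hp hq
  | monomial m a =>
    rw [← Polynomial.C_mul_X_pow_eq_monomial, map_mul, map_pow, AdjoinRoot.mk_X]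
    refine mul_mem ?_ (pow_mem (hx 1) m)
    induction a using Polynomial.induction_on' with
    | add p q hp hq => rw [map_add, map_add]; exact add_mem hp hq
    | monomial m a =>
      rw [← Polynomial.C_mul_X_pow_eq_monomial, map_mul, map_mul, map_pow, map_pow]
      exact mul_mem ⟨awayConst _ a, chartHom_awayConst _ _ _ a⟩ (pow_mem (hx 0) m)

instance : IsImmersion (affineCurveToPlane F) := by
  have : IsClosedImmersion (Spec.map (CommRingCat.ofHom
      (chartHom k ![xCoord F, yCoord F, 1] 2 (by simp)))) :=
    IsClosedImmersion.spec_of_surjective _ (chartHom_surjective F)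
  exact inferInstanceAs (IsImmersion (Spec.map (CommRingCat.ofHom
    (chartHom k ![xCoord F, yCoord F, 1] 2 (by simp))) ≫
      Proj.awayι _ _ (X_mem_homogeneousSubmodule k 2) one_pos))

instance : IsOpenImmersion (affineToProjective F) := by
  rw [affineToProjective]; infer_instance

end Immersion

/-! ### Local rings of the normalised curve and the morphism given by `x` -/

section Points

variable {k : Type u} [Field k] (F : k[X][Y]) [IsDomain (AdjoinRoot F)]

instance : IsDominant (normalisedGenericPoint F) := by
  rw [normalisedGenericPoint]; infer_instance

instance : AlgebraicGeometry.IsIntegral (normalisedCurve F) := inferInstance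

omit [IsDomain (AdjoinRoot F)] in
lemma normalisedGenericPoint_comp :
    normalisedGenericPoint F ≫ normalisationMap F = genericPoint F :=
  Scheme.Hom.toNormalization_fromNormalization _

/-- The embedding of the stalk at `P` in the function field. -/
def stalkEmbedding (P : normalisedCurve F) :
    (normalisedCurve F).presheaf.stalk P →+* FunctionField F :=
  (stalkToField (K := FunctionField F) (normalisedGenericPoint F) P).hom

lemma SpecMap_stalkEmbedding (P : normalisedCurve F) :
    Spec.map (CommRingCat.ofHom (stalkEmbedding F P)) ≫ (normalisedCurve F).fromSpecStalk P =
      normalisedGenericPoint F :=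
  SpecMap_stalkToField (K := FunctionField F) (normalisedGenericPoint F) P

lemma isIntegrallyClosedIn_stalkEmbedding (P : normalisedCurve F) :
    letI := (stalkEmbedding F P).toAlgebra
    IsIntegrallyClosedIn ((normalisedCurve F).presheaf.stalk P) (FunctionField F) :=
  isIntegrallyClosedIn_stalk (K := FunctionField F) (PlaneCurve.genericPoint F) P

lemma stalkEmbedding_injective (P : normalisedCurve F) :
    Function.Injective (stalkEmbedding F P) :=
  ((isIntegrallyClosedIn_iff_ringHom _).mp (isIntegrallyClosedIn_stalkEmbedding F P)).1

lemma genericPoint_imageι : genericPoint F ≫ (affineCurveToPlane F).imageι =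
    toProj k ![algebraMap (AdjoinRoot F) (FunctionField F) (xCoord F),
      algebraMap (AdjoinRoot F) (FunctionField F) (yCoord F), 1] 2 (by simp) := by
  rw [genericPoint, affineToProjective, Category.assoc, Scheme.Hom.toImage_imageι,
    affineCurveToPlane]
  exact SpecMap_toProj (IsScalarTower.toAlgHom k (AdjoinRoot F) (FunctionField F)) _ _
    (by simp [Fin.forall_fin_succ]) _ _ _

omit [IsDomain (AdjoinRoot F)] in
lemma eval₂_coordinates {S : Type*} [CommRing S] (f : AdjoinRoot F →+* S) :
    F.eval₂ (f.comp (AdjoinRoot.of F)) (f (yCoord F)) = 0 := by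
  rw [← Polynomial.hom_eval₂, yCoord, AdjoinRoot.eval₂_root, map_zero]

omit [IsDomain (AdjoinRoot F)] in
lemma aeval_xCoord : (Polynomial.aeval (R := k)
      (algebraMap (AdjoinRoot F) (FunctionField F) (xCoord F))).toRingHom =
    (algebraMap (AdjoinRoot F) (FunctionField F)).comp (AdjoinRoot.of F) := by
  refine Polynomial.ringHom_ext (fun c => ?_) ?_
  · refine (Polynomial.aeval_C _ c).trans ?_
    rw [IsScalarTower.algebraMap_apply k (AdjoinRoot F) (FunctionField F)]
    rfl
  · exact Polynomial.aeval_X _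

/-- At every point of the normalisation, `x` or `x⁻¹` is regular. -/
lemma xCoord_regular_or_inv_regular (hF0 : F ≠ 0) (P : normalisedCurve F) :
    ∃ κ : k →+* (normalisedCurve F).presheaf.stalk P,
      (stalkEmbedding F P).comp κ = algebraMap k (FunctionField F) ∧
      ((∃ r, stalkEmbedding F P r = algebraMap (AdjoinRoot F) (FunctionField F) (xCoord F)) ∨
        (algebraMap (AdjoinRoot F) (FunctionField F) (xCoord F) ≠ 0 ∧
          ∃ r, stalkEmbedding F P r =
            (algebraMap (AdjoinRoot F) (FunctionField F) (xCoord F))⁻¹)) := by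
  set x := algebraMap (AdjoinRoot F) (FunctionField F) (xCoord F) with hx
  set y := algebraMap (AdjoinRoot F) (FunctionField F) (yCoord F) with hy
  have hg : Spec.map (CommRingCat.ofHom (stalkEmbedding F P)) ≫
      ((normalisedCurve F).fromSpecStalk P ≫ normalisationMap F ≫
        (affineCurveToPlane F).imageι) = toProj k ![x, y, 1] 2 (by simp) := by
    rw [← Category.assoc, SpecMap_stalkEmbedding, ← Category.assoc, normalisedGenericPoint_comp,
      genericPoint_imageι]
  obtain ⟨i, hi⟩ := exists_mem_basicOpen_X (k := k) (n := 2)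
    (((normalisedCurve F).fromSpecStalk P ≫ normalisationMap F ≫
        (affineCurveToPlane F).imageι) (IsLocalRing.closedPoint _))
  obtain ⟨hvi, χ, hχ, -⟩ := exists_chartHom_lift
    (O := (normalisedCurve F).presheaf.stalk P) (stalkEmbedding F P) _ ![x, y, 1] 2 _ hg i hi
  have hκ : (stalkEmbedding F P).comp (χ.comp (awayConst _)) = algebraMap k (FunctionField F) := by
    rw [← RingHom.comp_assoc, hχ]
    exact RingHom.ext fun c => chartHom_awayConst _ i hvi c
  refine ⟨χ.comp (awayConst _), hκ, ?_⟩
  have hq (j : Fin 3) : stalkEmbedding F P (χ (HomogeneousLocalization.Away.isLocalizationElem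
      (X_mem_homogeneousSubmodule k i) (X_mem_homogeneousSubmodule k j))) * ![x, y, 1] i =
      ![x, y, 1] j := by
    rw [← RingHom.comp_apply, hχ]
    exact chartHom_X_div (k := k) ![x, y, 1] i j hvi
  have hne := hvi.ne_zero
  fin_cases i
  · exact .inr ⟨hne, _, eq_inv_of_mul_eq_one_left (hq 2)⟩
  · set v := χ (HomogeneousLocalization.Away.isLocalizationElem
      (X_mem_homogeneousSubmodule k 1) (X_mem_homogeneousSubmodule k 2))
    have hv : stalkEmbedding F P v * y = 1 := hq 2
    have hu := hq 0
    by_cases hvu : IsUnit v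
    · obtain ⟨w, hw⟩ := hvu
      refine .inl ⟨χ (HomogeneousLocalization.Away.isLocalizationElem
        (X_mem_homogeneousSubmodule k 1) (X_mem_homogeneousSubmodule k 0)) * ↑w⁻¹, ?_⟩
      have hw' : stalkEmbedding F P ↑w⁻¹ = y := by
        refine left_inv_eq_right_inv (a := stalkEmbedding F P v) ?_ hv
        rw [← map_mul, ← hw, Units.inv_mul, map_one]
      rw [map_mul, hw']
      exact hu
    -- Here `1/y` is in the maximal ideal; integral closedness and the equation of the curve must be
    -- used.
    · let := (stalkEmbedding F P).toAlgebra
      let := (χ.comp (awayConst _)).toAlgebra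
      have := isIntegrallyClosedIn_stalkEmbedding F P
      have : IsScalarTower k ((normalisedCurve F).presheaf.stalk P) (FunctionField F) :=
        .of_algebraMap_eq' hκ.symm
      refine mem_range_or_inv_mem_range_of_relation x y F hF0 ?_ v hvu hv
      rw [hx, aeval_xCoord]
      exact eval₂_coordinates F _
  · exact .inl ⟨_, by simpa using hq 0⟩

/-- The homogeneous coordinates `[x : 1]` of the generic point. -/
abbrev genericValue : Spec (.of (FunctionField F)) ⟶ projSpace k 1 :=
  toProj k ![algebraMap (AdjoinRoot F) (FunctionField F) (xCoord F), 1] 1 (by simp)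

lemma exists_stalk_extension (hF0 : F ≠ 0) (P : normalisedCurve F) :
    ∃ φ : Spec ((normalisedCurve F).presheaf.stalk P) ⟶ projSpace k 1,
      Spec.map (CommRingCat.ofHom (stalkEmbedding F P)) ≫ φ = genericValue F := by
  obtain ⟨κ, hκ, h⟩ := xCoord_regular_or_inv_regular F hF0 P
  exact exists_toProj_extension (stalkEmbedding F P) κ hκ _ h

lemma exists_isGivenByX [Finite k] (hF0 : F ≠ 0) :
    ∃ φ : normalisedCurve F ⟶ projSpace k 1, IsGivenByX F φ := by
  have := locallyOfFiniteType_projSpace k 1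
  refine exists_extension_of_stalks (normalisedGenericPoint F) (genericValue F) fun P => ?_
  obtain ⟨φ, hφ⟩ := exists_stalk_extension F hF0 P
  exact ⟨_, φ, SpecMap_stalkEmbedding F P, hφ⟩

variable {F} in
lemma IsGivenByX.unique {φ ψ : normalisedCurve F ⟶ projSpace k 1} (hφ : IsGivenByX F φ)
    (hψ : IsGivenByX F ψ) : ψ = φ :=
  ext_of_isDominant (normalisedGenericPoint F) (hψ.trans hφ.symm)

lemma SpecMap_xProjection_affineLineToProj :
    Spec.map (CommRingCat.ofHom (algebraMap (AdjoinRoot F) (FunctionField F))) ≫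
      xProjection F ≫ affineLineToProj k = genericValue F := by
  let f : Polynomial k →ₐ[k] FunctionField F := Polynomial.aeval
    (algebraMap (AdjoinRoot F) (FunctionField F) (xCoord F))
  rw [xProjection, ← Category.assoc, ← Spec.map_comp, ← CommRingCat.ofHom_comp,
    ← aeval_xCoord]
  exact SpecMap_toProj f _ _ (Fin.forall_fin_two.mpr ⟨by simp [f], by simp⟩) _ _ _

variable {F} in
/-- Over the affine curve, the morphism given by `x` is the projection to the affine line. -/
lemma IsGivenByX.apply_eq {φ : normalisedCurve F ⟶ projSpace k 1} (hφ : IsGivenByX F φ)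
    {P : normalisedCurve F} {Q : affineCurve F}
    (h : normalisationMap F P = affineToProjective F Q) :
    φ P = affineLineToProj k (xProjection F Q) := by
  let p₁ := Limits.pullback.fst (normalisationMap F) (affineToProjective F)
  let p₂ := Limits.pullback.snd (normalisationMap F) (affineToProjective F)
  let η := Limits.pullback.lift (f := normalisationMap F) (g := affineToProjective F)
    (normalisedGenericPoint F)
    (Spec.map (CommRingCat.ofHom (algebraMap (AdjoinRoot F) (FunctionField F))))
    (normalisedGenericPoint_comp F)
  have hη : η ≫ p₁ = normalisedGenericPoint F := Limits.pullback.lift_fst _ _ _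
  have : IsDominant (η ≫ p₁) := by rw [hη]; infer_instance
  have : IsDominant η := IsDominant.of_comp_of_isOpenImmersion η p₁
  have : IsReduced (Limits.pullback (normalisationMap F) (affineToProjective F)) :=
    isReduced_of_isOpenImmersion p₁
  have hη₂ : η ≫ p₂ = Spec.map (CommRingCat.ofHom (algebraMap (AdjoinRoot F) (FunctionField F))) :=
    Limits.pullback.lift_snd _ _ _
  -- The fibre product is the open part of the normalisation over `X₀`; it is reduced and dominated
  -- by `η`, so comparison at the generic point suffices.
  have key : p₁ ≫ φ = p₂ ≫ xProjection F ≫ affineLineToProj k := by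
    refine ext_of_isDominant η ?_
    rw [reassoc_of% hη, reassoc_of% hη₂, SpecMap_xProjection_affineLineToProj]
    exact hφ
  obtain ⟨z, rfl, rfl⟩ := Scheme.Pullback.exists_preimage_pullback P Q h
  exact congr($key z)

variable {F} in
/-- Where `x` takes a finite value that is not a zero of the leading coefficient, `y` is regular. -/
lemma IsGivenByX.exists_affine_point {φ : normalisedCurve F ⟶ projSpace k 1}
    (hφ : IsGivenByX F φ) {P : normalisedCurve F} {a : affineLine k}
    (h : φ P = affineLineToProj k a) (ha : a ∉ leadingCoeffZeros F) :
    ∃ Q, normalisationMap F P = affineToProjective F Q := by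
  let O := (normalisedCurve F).presheaf.stalk P
  let g := (normalisedCurve F).fromSpecStalk P ≫ φ
  let c : Spec ((normalisedCurve F).presheaf.stalk P) := IsLocalRing.closedPoint O
  have hclosed : (normalisedCurve F).fromSpecStalk P c = P :=
    Scheme.fromSpecStalk_closedPoint
  have hrange : Set.range g ⊆ Set.range (affineLineToProj k) := by
    rintro _ ⟨p, rfl⟩
    refine ((IsLocalRing.specializes_closedPoint p).map g.continuous).mem_open
      (affineLineToProj k).isOpenEmbedding.isOpen_range ⟨a, ?_⟩
    exact h.symm.trans (congrArg φ hclosed.symm)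
  obtain ⟨θ, hθ⟩ := Spec.map_surjective (IsOpenImmersion.lift (affineLineToProj k) g hrange)
  have hθg : Spec.map θ ≫ affineLineToProj k = g := by
    rw [hθ]; exact IsOpenImmersion.lift_fac _ _ _
  have hθa : Spec.map θ c = a := by
    refine (affineLineToProj k).isOpenEmbedding.injective ?_
    rw [← Scheme.Hom.comp_apply, hθg, ← h]
    exact congrArg φ hclosed
  -- The closed point maps to `a`, where the leading coefficient does not vanish.
  have hlc : IsUnit (θ.hom F.leadingCoeff) := by
    by_contra hu
    refine ha ?_
    rw [← hθa]
    refine (PrimeSpectrum.mem_zeroLocus _ _).mpr (Set.singleton_subset_iff.mpr ?_)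
    exact (IsLocalRing.mem_maximalIdeal _).mpr hu
  have hψθ : (stalkEmbedding F P).comp θ.hom =
      (algebraMap (AdjoinRoot F) (FunctionField F)).comp (AdjoinRoot.of F) := by
    have h₁ : Spec.map (CommRingCat.ofHom (stalkEmbedding F P)) ≫ Spec.map θ ≫
        affineLineToProj k = Spec.map (CommRingCat.ofHom (algebraMap (AdjoinRoot F)
          (FunctionField F))) ≫ xProjection F ≫ affineLineToProj k := by
      rw [hθg, SpecMap_xProjection_affineLineToProj, ← Category.assoc, SpecMap_stalkEmbedding]
      exact hφ
    rw [xProjection, ← Category.assoc, ← Category.assoc, cancel_mono, ← Spec.map_comp,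
      ← Spec.map_comp] at h₁
    exact congrArg CommRingCat.Hom.hom (Spec.map_injective h₁)
  have hinj := stalkEmbedding_injective F P
  obtain ⟨s, hs⟩ : ∃ s, stalkEmbedding F P s =
      algebraMap (AdjoinRoot F) (FunctionField F) (yCoord F) := by
    let := (stalkEmbedding F P).toAlgebra
    have := isIntegrallyClosedIn_stalkEmbedding F P
    refine mem_range_of_isUnit_leadingCoeff θ.hom F _ hlc ?_
    rw [RingHom.algebraMap_toAlgebra, hψθ]
    exact eval₂_coordinates F _
  have hrel : F.eval₂ θ.hom s = 0 := by
    refine hinj ?_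
    rw [map_zero, Polynomial.hom_eval₂, hψθ, hs]
    exact eval₂_coordinates F _
  let β : AdjoinRoot F →+* O := AdjoinRoot.lift θ.hom s hrel
  have hβ : (stalkEmbedding F P).comp β = algebraMap (AdjoinRoot F) (FunctionField F) := by
    refine AdjoinRoot.ringHom_ext ?_ ?_
    · rw [RingHom.comp_assoc, AdjoinRoot.lift_comp_of, hψθ]
    · exact (congrArg _ (AdjoinRoot.lift_root hrel)).trans hs
  -- With `x` and `y` both in `O`, `β` gives a map from `Spec O` to `X₀`; it agrees with the
  -- normalisation map generically, hence at the closed point.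
  have key : Spec.map (CommRingCat.ofHom β) ≫ affineToProjective F =
      (normalisedCurve F).fromSpecStalk P ≫ normalisationMap F := by
    refine eq_of_SpecMap_comp_eq (O := O) (stalkEmbedding F P) hinj _ _ ?_
    rw [← Category.assoc, ← Spec.map_comp, ← CommRingCat.ofHom_comp, hβ, ← Category.assoc,
      SpecMap_stalkEmbedding, normalisedGenericPoint_comp]
    rfl
  refine ⟨Spec.map (CommRingCat.ofHom β) c, ?_⟩
  exact ((congrArg _ hclosed).symm.trans congr($key c).symm)

end Points

end

end PlaneCurve

open PlaneCurve in
theorem proposition5 {k : Type u} [Field k] [Finite k] (F : k[X][Y])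
    (hF : PlaneCurve.AbsolutelyIrreducible F) (hd : 2 ≤ PlaneCurve.totalDegree F) :
    ∃ φ : PlaneCurve.normalisedCurve F ⟶ PlaneCurve.projSpace k 1,
      PlaneCurve.IsGivenByX F φ ∧
      (∀ ψ : PlaneCurve.normalisedCurve F ⟶ PlaneCurve.projSpace k 1,
        PlaneCurve.IsGivenByX F ψ → ψ = φ) ∧
      PlaneCurve.normalisationMap F ⁻¹' PlaneCurve.setZ F = φ ⁻¹' PlaneCurve.setY F := by
  have := hF.isDomain
  obtain ⟨φ, hφ⟩ := exists_isGivenByX F hF.ne_zero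
  refine ⟨φ, hφ, fun ψ hψ => hφ.unique hψ, ?_⟩
  have hj : Function.Injective (affineToProjective F) :=
    (affineToProjective F).isOpenEmbedding.injective
  have hl : Function.Injective (affineLineToProj k) :=
    (affineLineToProj k).isOpenEmbedding.injective
  have hinf := range_infinityPoint k
  ext P
  -- Complements are easier to compare: membership there gives a point of `X₀` or of `𝔸¹` to work
  -- with.
  rw [← not_iff_not]
  constructor
  · intro hP
    obtain ⟨Q, hQ⟩ : normalisationMap F P ∈ Set.range (affineToProjective F) := by
      by_contra h
      exact hP (.inr h)
    have hval := hφ.apply_eq hQ.symm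
    rintro (⟨a, ha, haP⟩ | h)
    · refine hP (.inl ⟨Q, ?_, hQ⟩)
      rw [hval] at haP
      rwa [hl haP] at ha
    · rw [hinf, hval] at h
      exact h ⟨_, rfl⟩
  · intro hP
    obtain ⟨a, ha⟩ : φ P ∈ Set.range (affineLineToProj k) := by
      by_contra h
      exact hP (.inr (hinf ▸ h))
    have haY : a ∉ setY₀ F := fun h => hP (.inl ⟨a, h, ha⟩)
    obtain ⟨Q, hQ⟩ := hφ.exists_affine_point ha.symm fun h => haY (.inr h)
    rintro (⟨Q', hQ', hQP⟩ | h)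
    · have := hφ.apply_eq hQP.symm
      rw [← ha] at this
      exact haY (hl this ▸ hQ')
    · exact h ⟨Q, hQ.symm⟩
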